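/- Let $L$ be the first-order language of rings with identity, with binary function symbols $+$, $\cdot$ and the constant symbol $1$ (and equality). For a field $K$ and a set $X$ (possibly empty or infinite), let $\mathbb{A}_K(X)$ be the free associative unital (non-commutative) $K$-algebra with basis $X$, regarded as an $L$-structure through its ring operations only. There is a family $(\Psi_n)_{n\in\mathbb{N}}$, $\mathbb{N}=\{0,1,2,\dots\}$, of sets of sentences of $L$, not depending on any field or set, such that for every $n\in\mathbb{N}$, every field $K$ and every set $X$, $$\mathbb{A}_K(X)\models\Psi_n \iff |X|=n .$$ In particular, if $X$ is infinite, then for every field $K$ and every $t\in\mathbb{N}$ the algebra $\mathbb{A}_K(X)$ does not satisfy $\Psi_t$. -/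

import Mathlib

open FirstOrder

universe u v

/-- The function symbols of the language of rings with identity: binary `+` and `*`, and the
constant `1`. -/
inductive UnitalRingFunc : ℕ → Type
  | add : UnitalRingFunc 2
  | mul : UnitalRingFunc 2
  | one : UnitalRingFunc 0

/-- The first-order language `{+, *, 1}` of rings with identity. Equality is logical; zero and
negation are not symbols of the language (they are definable in every ring). -/
def unitalRingLanguage : FirstOrder.Language where
  Functions := UnitalRingFunc
  Relations := fun _ => Empty

/-- The free unital associative `K`-algebra on `X`, as a structure in the language
`{+, *, 1}`: the symbols are interpreted by its ring operations. There are no symbols for the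
elements of `K` or of `X`. -/
noncomputable instance freeAlgebraStructure (K : Type u) (X : Type v) [Field K] :
    unitalRingLanguage.Structure (FreeAlgebra K X) where
  funMap := fun {n} f =>
    match n, f with
    | _, UnitalRingFunc.add => fun x => x 0 + x 1
    | _, UnitalRingFunc.mul => fun x => x 0 * x 1
    | _, UnitalRingFunc.one => fun _ => 1
  RelMap := fun {_} r => Empty.elim r

/-! The rank is at most `n` exactly when some `n` elements generate a proper right ideal `I` with `A
= K + I`. The augmentation ideal gives one direction. Conversely, such an `I` lies in the kernel of
a character `χ`, and the `χ`-derivation sending each generator `x` to the basis vector `e_x` of `X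
→₀ K` maps the generators of `I` onto a spanning set, so `|X| ≤ n`. The condition is first-order
because `K` is definable: its elements are `0` and the right invertible elements. Rank exactly `n`
means at most `n`, and not at most `m` for each `m < n`. -/

open FirstOrder.Language

/-! ### Right invertible elements of a free algebra -/

section FreeAlgebraFacts

variable {K : Type u} [Field K] {X : Type v}

/-- The homomorphism to polynomials over the free algebra that multiplies each generator by the
polynomial variable. -/
noncomputable def FreeAlgebra.homogenize (K : Type u) [Field K] (X : Type v) :
    FreeAlgebra K X →ₐ[K] Polynomial (FreeAlgebra K X) :=
  FreeAlgebra.lift K fun x => Polynomial.C (FreeAlgebra.ι K x) * Polynomial.X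

theorem FreeAlgebra.eval_one_homogenize (a : FreeAlgebra K X) :
    (FreeAlgebra.homogenize K X a).eval 1 = a := by
  induction a using FreeAlgebra.induction with
  | grade0 r => simp [Polynomial.algebraMap_apply]
  | grade1 x => simp [FreeAlgebra.homogenize]
  | mul a b ha hb =>
    have h := (Polynomial.eval₂RingHom' (RingHom.id (FreeAlgebra K X)) 1
      fun a => Commute.one_right a).map_mul (homogenize K X a) (homogenize K X b)
    rw [map_mul]
    exact h.trans (congrArg₂ (· * ·) ha hb)
  | add a b ha hb => rw [map_add, Polynomial.eval_add, ha, hb]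

theorem FreeAlgebra.coeff_zero_homogenize (a : FreeAlgebra K X) :
    (FreeAlgebra.homogenize K X a).coeff 0 = algebraMap K _ (FreeAlgebra.algebraMapInv a) := by
  induction a using FreeAlgebra.induction with
  | grade0 r => simp [Polynomial.algebraMap_apply, FreeAlgebra.algebraMap_leftInverse r]
  | grade1 x => simp [FreeAlgebra.homogenize, FreeAlgebra.algebraMapInv]
  | mul a b ha hb => rw [map_mul, Polynomial.mul_coeff_zero, ha, hb, map_mul, map_mul]
  | add a b ha hb => rw [map_add, Polynomial.coeff_add, ha, hb, map_add, map_add]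

/-- A right invertible element of a free algebra over a field is a scalar. -/
theorem FreeAlgebra.eq_algebraMap_of_mul_eq_one {a b : FreeAlgebra K X} (h : a * b = 1) :
    ∃ r : K, a = algebraMap K _ r := by
  have hm : homogenize K X a * homogenize K X b = 1 := by rw [← map_mul, h, map_one]
  have hdeg := congrArg Polynomial.natDegree hm
  -- Without zero divisors degrees add, so both factors are constant in the variable.
  rw [Polynomial.natDegree_mul (left_ne_zero_of_mul_eq_one hm) (right_ne_zero_of_mul_eq_one hm),
    Polynomial.natDegree_one, Nat.add_eq_zero_iff] at hdeg
  have hC := Polynomial.eq_C_of_natDegree_eq_zero hdeg.1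
  have h1 := eval_one_homogenize a
  rw [hC, Polynomial.eval_C, coeff_zero_homogenize] at h1
  exact ⟨algebraMapInv a, h1.symm⟩

/-! ### Generators of right ideals of codimension one -/

/-- If all generators agree modulo a finitely generated right ideal with scalars, then every
element agrees with its image under the corresponding character. -/
theorem FreeAlgebra.exists_eq_character_add_sum {ι : Type*} [Fintype ι]
    (g : ι → FreeAlgebra K X) (c : X → K)
    (hc : ∀ x, ∃ y : ι → FreeAlgebra K X,
      FreeAlgebra.ι K x = algebraMap K _ (c x) + ∑ i, g i * y i)
    (a : FreeAlgebra K X) :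
    ∃ y : ι → FreeAlgebra K X,
      a = algebraMap K _ (FreeAlgebra.lift K c a) + ∑ i, g i * y i := by
  induction a using FreeAlgebra.induction with
  | grade0 r => exact ⟨0, by simp⟩
  | grade1 x => simpa using hc x
  | mul a b ha hb =>
    obtain ⟨y, hy⟩ := ha
    obtain ⟨z, hz⟩ := hb
    -- `ab - χ(a)χ(b) = (a - χ(a))b + (b - χ(b))χ(a)`, scalars being central.
    refine ⟨fun i => y i * b + z i * algebraMap K _ (lift K c a), ?_⟩
    simp only [mul_add, Finset.sum_add_distrib, ← mul_assoc, ← Finset.sum_mul]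
    rw [eq_sub_of_add_eq' hy.symm, eq_sub_of_add_eq' hz.symm, map_mul, map_mul, sub_mul, sub_mul,
      Algebra.commutes (lift K c a) b, Algebra.commutes (lift K c a) (algebraMap K _ (lift K c b))]
    abel
  | add a b ha hb =>
    obtain ⟨y, hy⟩ := ha
    obtain ⟨z, hz⟩ := hb
    refine ⟨y + z, ?_⟩
    simp only [Pi.add_apply, mul_add, Finset.sum_add_distrib, map_add]
    nth_rewrite 1 [hy, hz]
    abel

/-- A free algebra of rank at most `n` has an augmentation ideal generated by `n` elements. -/
theorem FreeAlgebra.exists_augmentation_generators {n : ℕ}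
    (h : Cardinal.mk X ≤ (n : Cardinal.{v})) :
    ∃ g : Fin n → FreeAlgebra K X, (∀ y : Fin n → FreeAlgebra K X, ∑ i, g i * y i ≠ 1) ∧
      ∀ a, ∃ (r : K) (y : Fin n → FreeAlgebra K X), a = algebraMap K _ r + ∑ i, g i * y i := by
  classical
  obtain ⟨e⟩ : Nonempty (X ↪ Fin n) := by
    rw [← Cardinal.lift_mk_le']
    simpa using h
  -- The generators of the algebra, padded with zeros up to length `n`.
  set g : Fin n → FreeAlgebra K X := Function.extend e (FreeAlgebra.ι K) 0
  have hge (x : X) : g (e x) = FreeAlgebra.ι K x := e.injective.extend_apply _ _ x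
  have hg (i : Fin n) : algebraMapInv (g i) = 0 := by
    by_cases hi : ∃ x, e x = i
    · obtain ⟨x, rfl⟩ := hi
      rw [hge]
      simp [algebraMapInv]
    · simp [g, Function.extend_apply' _ _ _ hi]
  refine ⟨g, fun y hy => ?_, fun a => ⟨_, exists_eq_character_add_sum g 0 (fun x => ?_) a⟩⟩
  · simpa [hg] using congrArg algebraMapInv hy
  · refine ⟨Pi.single (e x) 1, ?_⟩
    simp [Pi.single_apply, hge]

/-- A right ideal of codimension one in a free algebra needs at least as many generators as the
rank of the free algebra. -/
theorem FreeAlgebra.mk_le_of_generators {n : ℕ} (g : Fin n → FreeAlgebra K X)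
    (hg : ∀ y : Fin n → FreeAlgebra K X, ∑ i, g i * y i ≠ 1)
    (hspan : ∀ a, ∃ (r : K) (y : Fin n → FreeAlgebra K X), a = algebraMap K _ r + ∑ i, g i * y i) :
    Cardinal.mk X ≤ (n : Cardinal.{v}) := by
  classical
  choose c hc using fun x : X => hspan (FreeAlgebra.ι K x)
  have hχ (i : Fin n) : lift K c (g i) = 0 := by
    by_contra hne
    obtain ⟨y, hy⟩ := exists_eq_character_add_sum g c hc (g i)
    -- Since `g i - χ(g i)` lies in the ideal, so does the nonzero scalar `χ(g i)`, hence also `1`.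
    refine hg (fun j => ((Pi.single i 1 : Fin n → FreeAlgebra K X) - y) j * algebraMap K _ (lift K c (g i))⁻¹) ?_
    simp only [← mul_assoc, ← Finset.sum_mul, Pi.sub_apply, mul_sub, Finset.sum_sub_distrib]
    rw [eq_sub_of_add_eq' hy.symm]
    simp [Pi.single_apply, ← map_mul, hne]
  -- `D a = (χ(a), δ(a))` with `δ(ab) = χ(a)δ(b) + χ(b)δ(a)`.
  let D : FreeAlgebra K X →ₐ[K] TrivSqZeroExt K (X →₀ K) :=
    lift K fun x => TrivSqZeroExt.inl (c x) + TrivSqZeroExt.inr (Finsupp.single x 1)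
  have hfst (a : FreeAlgebra K X) : (D a).fst = lift K c a := by
    have : (TrivSqZeroExt.fstHom K K (X →₀ K)).comp D = lift K c := by
      ext x
      simp [D]
    exact DFunLike.congr_fun this a
  have htop : Submodule.span K (Set.range fun i => (D (g i)).snd) = ⊤ := by
    rw [eq_top_iff, ← Finsupp.basisSingleOne.span_eq, Submodule.span_le]
    rintro _ ⟨x, rfl⟩
    obtain ⟨y, hy⟩ := hc x
    -- As `χ(g i) = 0`, applying `δ` leaves `e_x = ∑ χ(y i) δ(g i)`.
    have h := congrArg (fun a => (D a).snd) hy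
    have hx : (D (FreeAlgebra.ι K x)).snd = Finsupp.single x 1 := by simp [D]
    simp only [map_add, map_sum, map_mul, AlgHom.commutes, TrivSqZeroExt.snd_add,
      TrivSqZeroExt.snd_sum, TrivSqZeroExt.snd_mul, hfst, hχ, hx] at h
    simp only [Finsupp.coe_basisSingleOne, SetLike.mem_coe, h]
    simp only [TrivSqZeroExt.algebraMap_eq_inl, TrivSqZeroExt.snd_inl, zero_smul, zero_add,
      op_smul_eq_smul]
    exact Submodule.sum_mem _ fun i _ =>
      Submodule.smul_mem _ _ (Submodule.subset_span ⟨i, rfl⟩)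
  have : Module.Finite K (X →₀ K) := ⟨htop ▸ Submodule.fg_span (Set.finite_range _)⟩
  have : Finite X := Module.Finite.finite_basis (Finsupp.basisSingleOne (R := K))
  have : Fintype X := Fintype.ofFinite X
  have hle := finrank_range_le_card (R := K) fun i => (D (g i)).snd
  rw [Set.finrank, htop, finrank_top, Module.finrank_finsupp_self, Fintype.card_fin] at hle
  rw [Cardinal.mk_fintype]
  exact_mod_cast hle

end FreeAlgebraFacts

/-! ### Expressing the rank by first-order sentences -/

namespace UnitalRing

/-- The sum of two terms. -/
def addTerm {α : Type*} (s t : unitalRingLanguage.Term α) : unitalRingLanguage.Term α :=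
  Functions.apply₂ (L := unitalRingLanguage) UnitalRingFunc.add s t

/-- The product of two terms. -/
def mulTerm {α : Type*} (s t : unitalRingLanguage.Term α) : unitalRingLanguage.Term α :=
  Functions.apply₂ (L := unitalRingLanguage) UnitalRingFunc.mul s t

/-- The constant `1` as a term. -/
def oneTerm {α : Type*} : unitalRingLanguage.Term α :=
  Constants.term (L := unitalRingLanguage) UnitalRingFunc.one

/-- The term `s + ∑ i, f i`. -/
def addSumTerm {α : Type*} {n : ℕ} (s : unitalRingLanguage.Term α)
    (f : Fin n → unitalRingLanguage.Term α) : unitalRingLanguage.Term α :=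
  ((List.finRange n).map f).foldl addTerm s

section Realize

variable {K : Type u} [Field K] {X : Type v} {α : Type*} (w : α → FreeAlgebra K X)

@[simp]
theorem realize_addTerm (s t : unitalRingLanguage.Term α) :
    (addTerm s t).realize w = s.realize w + t.realize w :=
  Term.realize_functions_apply₂

@[simp]
theorem realize_mulTerm (s t : unitalRingLanguage.Term α) :
    (mulTerm s t).realize w = s.realize w * t.realize w :=
  Term.realize_functions_apply₂

@[simp]
theorem realize_oneTerm :
    (oneTerm : unitalRingLanguage.Term α).realize w = 1 :=
  Term.realize_constants

@[simp]
theorem realize_addSumTerm {n : ℕ} (s : unitalRingLanguage.Term α)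
    (f : Fin n → unitalRingLanguage.Term α) :
    (addSumTerm s f).realize w = s.realize w + ∑ i, (f i).realize w := by
  have (l : List (Fin n)) (s : unitalRingLanguage.Term α) :
      ((l.map f).foldl addTerm s).realize w =
        s.realize w + (l.map fun i => (f i).realize w).sum := by
    induction l generalizing s with
    | nil => simp
    | cons i l ih => simp [ih, add_assoc]
  rw [addSumTerm, this, ← List.ofFn_eq_map, List.sum_ofFn]

end Realize

/-- The formula in `z` (index `none`) and `g i` (index `some i`) saying that `z + ∑ i, g i * y i`
is never equal to `1`. -/
noncomputable def properFormula (n : ℕ) : unitalRingLanguage.Formula (Empty ⊕ Option (Fin n)) :=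
  Formula.not <| Formula.iExs (Fin n) <| Term.equal
    (addSumTerm (Term.var (.inl (.inr none)))
      fun i => mulTerm (Term.var (.inl (.inr (some i)))) (Term.var (.inr i)))
    oneTerm

/-- The formula in `z` (index `none`) and `g i` (index `some i`) saying that every element is of
the form `k + ∑ i, g i * y i`, where `k` is equal to `z` or right invertible. -/
noncomputable def spanFormula (n : ℕ) : unitalRingLanguage.Formula (Empty ⊕ Option (Fin n)) :=
  Formula.iAlls Unit <| Formula.iExs (Fin n ⊕ Bool) <|
    -- Index `true` holds `k`, and `false` its candidate right inverse.
    (Term.equal (Term.var (.inr (.inr true))) (Term.var (.inl (.inl (.inr none)))) ⊔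
      Term.equal (mulTerm (Term.var (.inr (.inr true))) (Term.var (.inr (.inr false)))) oneTerm) ⊓
    Term.equal (Term.var (.inl (.inr ())))
      (addSumTerm (Term.var (.inr (.inr true)))
        fun i => mulTerm (Term.var (.inl (.inl (.inr (some i))))) (Term.var (.inr (.inl i))))

/-- The sentence saying that `n` elements generate a right ideal of codimension one. -/
noncomputable def rankLeSentence (n : ℕ) : unitalRingLanguage.Sentence :=
  Formula.iExs (Option (Fin n)) <|
    -- `z + z = z` defines zero, which is not a symbol of the language.
    Term.equal (addTerm (Term.var (.inr none)) (Term.var (.inr none))) (Term.var (.inr none)) ⊓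
      (properFormula n ⊓ spanFormula n)

variable {K : Type u} [Field K] {X : Type v}

theorem realize_rankLeSentence (n : ℕ) :
    FreeAlgebra K X ⊨ rankLeSentence n ↔
      ∃ g : Fin n → FreeAlgebra K X, (∀ y : Fin n → FreeAlgebra K X, ∑ i, g i * y i ≠ 1) ∧
        ∀ a, ∃ (k l : FreeAlgebra K X) (y : Fin n → FreeAlgebra K X),
          (k = 0 ∨ k * l = 1) ∧ a = k + ∑ i, g i * y i := by
  simp only [Sentence.Realize, rankLeSentence, properFormula, spanFormula, Formula.realize_iExs,
    Formula.realize_iAlls, Formula.realize_inf, Formula.realize_sup, Formula.realize_not,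
    Formula.realize_equal, realize_addTerm, realize_mulTerm, realize_oneTerm, realize_addSumTerm,
    Term.realize_var, Sum.elim_inl, Sum.elim_inr, add_eq_left]
  constructor
  · rintro ⟨f, hz, hp, hs⟩
    rw [hz] at hp hs
    refine ⟨fun i => f (some i), fun y hy => hp ⟨y, by rw [zero_add, hy]⟩, fun a => ?_⟩
    obtain ⟨y, hy⟩ := hs fun _ => a
    exact ⟨y (.inr true), y (.inr false), fun i => y (.inl i), hy⟩
  · rintro ⟨g, hp, hs⟩
    refine ⟨fun o => o.elim 0 g, rfl, ?_, fun a => ?_⟩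
    · rintro ⟨y, hy⟩
      exact hp y (by simpa using hy)
    · obtain ⟨k, l, y, h⟩ := hs (a ())
      exact ⟨Sum.elim y fun b => if b then k else l, by simpa using h⟩

theorem realize_rankLeSentence_iff (n : ℕ) :
    FreeAlgebra K X ⊨ rankLeSentence n ↔ Cardinal.mk X ≤ (n : Cardinal.{v}) := by
  rw [realize_rankLeSentence]
  constructor
  · rintro ⟨g, hg, hs⟩
    refine FreeAlgebra.mk_le_of_generators (K := K) g hg fun a => ?_
    obtain ⟨k, l, y, rfl | hk, ha⟩ := hs a
    · exact ⟨0, y, by rw [map_zero, ha]⟩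
    · obtain ⟨r, rfl⟩ := FreeAlgebra.eq_algebraMap_of_mul_eq_one hk
      exact ⟨r, y, ha⟩
  · intro h
    obtain ⟨g, hg, hs⟩ := FreeAlgebra.exists_augmentation_generators (K := K) h
    refine ⟨g, hg, fun a => ?_⟩
    obtain ⟨r, y, ha⟩ := hs a
    refine ⟨algebraMap K _ r, algebraMap K _ r⁻¹, y, ?_, ha⟩
    rcases eq_or_ne r 0 with rfl | hr
    · exact Or.inl (map_zero _)
    · exact Or.inr (by rw [← map_mul, mul_inv_cancel₀ hr, map_one])

/-- The theory saying that a free algebra has rank exactly `n`. -/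
noncomputable def rankTheory (n : ℕ) : unitalRingLanguage.Theory :=
  {rankLeSentence n} ∪ (fun m => Formula.not (rankLeSentence m)) '' Set.Iio n

theorem model_rankTheory_iff (n : ℕ) :
    FreeAlgebra K X ⊨ rankTheory n ↔ Cardinal.mk X = (n : Cardinal.{v}) := by
  simp only [rankTheory, Theory.model_union_iff, Theory.model_singleton_iff,
    realize_rankLeSentence_iff]
  simp only [Theory.model_iff, Set.forall_mem_image, Sentence.realize_not,
    realize_rankLeSentence_iff, Set.mem_Iio, not_le]
  constructor
  · rintro ⟨hle, hlt⟩
    -- The bound makes the cardinal a natural number `m`; if `m < n`, the negated sentence for `m`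
    -- fails.
    obtain ⟨m, hm⟩ := Cardinal.lt_aleph0.1 (hle.trans_lt Cardinal.natCast_lt_aleph0)
    rw [hm] at hle hlt ⊢
    refine le_antisymm hle ?_
    by_contra hmn
    exact lt_irrefl _ (hlt (by exact_mod_cast not_le.1 hmn))
  · rintro h
    rw [h]
    exact ⟨le_rfl, fun m hm => by exact_mod_cast hm⟩

end UnitalRing

theorem mainTheorem11 :
    ∃ Ψ : ℕ → unitalRingLanguage.Theory,
      (∀ (n : ℕ) (K : Type u) [Field K] (X : Type v),
        FreeAlgebra K X ⊨ Ψ n ↔ Cardinal.mk X = (n : Cardinal.{v})) ∧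
      (∀ (K : Type u) [Field K] (X : Type v), Infinite X →
        ∀ t : ℕ, ¬ FreeAlgebra K X ⊨ Ψ t) := by
  refine ⟨UnitalRing.rankTheory, fun n K _ X => UnitalRing.model_rankTheory_iff n,
    fun K _ X hX t h => ?_⟩
  have hlt := Cardinal.natCast_lt_aleph0 (n := t)
  rw [← (UnitalRing.model_rankTheory_iff t).1 h] at hlt
  exact not_le.2 hlt (Cardinal.infinite_iff.1 hX)
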